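/- **Theorem 4.8.** Let $\mathcal C$ be a unitary tensor category, i.e. a semisimple rigid C*-tensor category with simple unit object $\mathbb 1$: a $\mathbb C$-linear monoidal category with bilinear tensor product, finite-dimensional hom spaces and duals, $\mathrm{End}(\mathbb 1)=\mathbb C$, equipped with a conjugate-linear involutive contravariant functor $f\mapsto f^\dagger$ that fixes objects, satisfies $(f\otimes g)^\dagger=f^\dagger\otimes g^\dagger$, makes the associativity and unit constraints unitary and makes $\mathcal C$ a C*-category, with finite orthogonal direct sums, and in which every $p=p^2=p^\dagger\in\mathrm{End}(X)$ is of the form $p=i\circ i^\dagger$ with $i^\dagger\circ i=\mathrm{id}_Y$ for some $i:Y\to X$. A *Frobenius algebra* $(X,m,e,\delta,\epsilon)$ in $\mathcal C$ is a unital algebra $(X,m,e)$ that is also a counital coalgebra $(X,\delta,\epsilon)$ with $(\mathrm{id}_X\otimes m)\circ(\delta\otimes\mathrm{id}_X)=\delta\circ m=(m\otimes\mathrm{id}_X)\circ(\mathrm{id}_X\otimes\delta)$. It is *unitary* if $m^\dagger=\delta$ and $e^\dagger=\epsilon$, and *connected* if $\dim_{\mathbb C}\mathrm{Hom}(\mathbb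 1,X)=1$. Let $X$ be a connected unitary Frobenius algebra in $\mathcal C$, and let $b:X\to X$ satisfy $b\circ e=e$ (unital), $b^\dagger=b$ (self-adjoint) and $b\circ b=b$ (idempotent). Then the following are equivalent: 1. $b$ arises from a unitary Frobenius subalgebra of $X$: there are a unitary Frobenius algebra $Y$ in $\mathcal C$ and a unital algebra monomorphism $i:Y\to X$ with $i^\dagger\circ i=\mathrm{id}_Y$ and $b=i\circ i^\dagger$. 2. $b$ satisfies the exchange relations $$b\circ m\circ(b\otimes\mathrm{id}_X)=m\circ(b\otimes b)=b\circ m\circ(\mathrm{id}_X\otimes b).$$ -/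

import Mathlib

open CategoryTheory MonoidalCategory MonObj ComonObj

/-- A dagger category: every morphism `f : X ⟶ Y` has an adjoint `dagger f : Y ⟶ X`, and
`dagger` is an involutive contravariant functor which is the identity on objects. -/
class DaggerCategory (C : Type*) [Category C] where
  dagger : ∀ {X Y : C}, (X ⟶ Y) → (Y ⟶ X)
  dagger_id : ∀ X : C, dagger (𝟙 X) = 𝟙 X
  dagger_comp : ∀ {X Y Z : C} (f : X ⟶ Y) (g : Y ⟶ Z), dagger (f ≫ g) = dagger g ≫ dagger f
  dagger_dagger : ∀ {X Y : C} (f : X ⟶ Y), dagger (dagger f) = f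

/-- A C*-category: a `ℂ`-linear dagger category with conjugate-linear dagger, whose hom spaces are
Banach spaces for a submultiplicative norm satisfying the C*-identity `‖f† ∘ f‖ = ‖f‖ ^ 2`, and such
that `f† ∘ f` is a positive element of `End X` for every `f : X ⟶ Y`.
(Recall that `f ≫ g` is `g ∘ f`.) -/
class CStarCategory (C : Type*) [Category C] [Preadditive C] [Linear ℂ C]
    extends DaggerCategory C where
  dagger_add : ∀ {X Y : C} (f g : X ⟶ Y), dagger (f + g) = dagger f + dagger g
  dagger_smul : ∀ {X Y : C} (c : ℂ) (f : X ⟶ Y),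
    dagger (c • f) = (starRingEnd ℂ) c • dagger f
  /-- the norm on the hom spaces -/
  homNorm : ∀ {X Y : C}, (X ⟶ Y) → ℝ
  homNorm_add_le : ∀ {X Y : C} (f g : X ⟶ Y), homNorm (f + g) ≤ homNorm f + homNorm g
  homNorm_smul : ∀ {X Y : C} (c : ℂ) (f : X ⟶ Y), homNorm (c • f) = ‖c‖ * homNorm f
  eq_zero_of_homNorm_eq_zero : ∀ {X Y : C} (f : X ⟶ Y), homNorm f = 0 → f = 0
  homNorm_complete : ∀ {X Y : C} (s : ℕ → (X ⟶ Y)),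
    (∀ r : ℝ, 0 < r → ∃ N, ∀ m ≥ N, ∀ n ≥ N, homNorm (s m - s n) < r) →
      ∃ f : X ⟶ Y, ∀ r : ℝ, 0 < r → ∃ N, ∀ n ≥ N, homNorm (s n - f) < r
  homNorm_comp_le : ∀ {X Y Z : C} (f : X ⟶ Y) (g : Y ⟶ Z),
    homNorm (f ≫ g) ≤ homNorm f * homNorm g
  homNorm_comp_dagger : ∀ {X Y : C} (f : X ⟶ Y), homNorm (f ≫ dagger f) = homNorm f ^ 2
  exists_comp_dagger_eq : ∀ {X Y : C} (f : X ⟶ Y), ∃ g : X ⟶ X, f ≫ dagger f = g ≫ dagger g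

/-- A C*-tensor category: a monoidal C*-category with bilinear tensor product, such that the dagger
is compatible with the tensor product and the associativity and unit constraints are unitary. -/
class CStarTensorCategory (C : Type*) [Category C] [Preadditive C] [Linear ℂ C]
    [MonoidalCategory C] [MonoidalPreadditive C] [MonoidalLinear ℂ C]
    extends CStarCategory C where
  dagger_tensorHom : ∀ {X₁ Y₁ X₂ Y₂ : C} (f : X₁ ⟶ Y₁) (g : X₂ ⟶ Y₂),
    dagger (f ⊗ₘ g) = dagger f ⊗ₘ dagger g
  dagger_associator_hom : ∀ X Y Z : C, dagger (α_ X Y Z).hom = (α_ X Y Z).inv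
  dagger_leftUnitor_hom : ∀ X : C, dagger (λ_ X).hom = (λ_ X).inv
  dagger_rightUnitor_hom : ∀ X : C, dagger (ρ_ X).hom = (ρ_ X).inv

/-- A unitary tensor category: a semisimple rigid C*-tensor category with simple unit.
For a C*-category, being semisimple abelian with finite-dimensional hom spaces amounts to the
fields `finiteDimensional_hom`, `exists_orthogonal_sum` (finite orthogonal direct sums exist) and
`exists_isometry_of_projection` (every projection is the range projection of an isometry);
the zero object is obtained by splitting the projection `0`. -/
class UnitaryTensorCategory (C : Type*) [Category C] [Preadditive C] [Linear ℂ C]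
    [MonoidalCategory C] [MonoidalPreadditive C] [MonoidalLinear ℂ C] [RigidCategory C]
    extends CStarTensorCategory C where
  finiteDimensional_hom : ∀ X Y : C, FiniteDimensional ℂ (X ⟶ Y)
  finrank_end_unit : Module.finrank ℂ (𝟙_ C ⟶ 𝟙_ C) = 1
  exists_orthogonal_sum : ∀ X Y : C, ∃ (W : C) (u : X ⟶ W) (v : Y ⟶ W),
    u ≫ dagger u = 𝟙 X ∧ v ≫ dagger v = 𝟙 Y ∧ dagger u ≫ u + dagger v ≫ v = 𝟙 W
  exists_isometry_of_projection : ∀ {X : C} (p : X ⟶ X), p ≫ p = p → dagger p = p →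
    ∃ (Y : C) (i : Y ⟶ X), i ≫ dagger i = 𝟙 Y ∧ dagger i ≫ i = p

/-- A Frobenius algebra: an object with a unital algebra structure `(μ, η)` and a counital coalgebra
structure `(Δ, ε)` such that `(id ⊗ μ) ∘ (Δ ⊗ id) = Δ ∘ μ = (μ ⊗ id) ∘ (id ⊗ Δ)`. -/
class FrobeniusObj {C : Type*} [Category C] [MonoidalCategory C] (X : C)
    extends MonObj X, ComonObj X where
  comul_whiskerRight_mul : Δ[X] ▷ X ≫ (α_ X X X).hom ≫ X ◁ μ[X] = μ[X] ≫ Δ[X]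
  whiskerLeft_comul_mul : X ◁ Δ[X] ≫ (α_ X X X).inv ≫ μ[X] ▷ X = μ[X] ≫ Δ[X]

/-- A Frobenius algebra in a dagger category is unitary if its comultiplication is the adjoint of its
multiplication and its counit is the adjoint of its unit. -/
def FrobeniusObj.IsUnitary {C : Type*} [Category C] [MonoidalCategory C] [DaggerCategory C]
    (X : C) [FrobeniusObj X] : Prop :=
  DaggerCategory.dagger μ[X] = Δ[X] ∧ DaggerCategory.dagger η[X] = ε[X]

/-- A unital algebra `X` is connected if `Hom(𝟙, X)` is one-dimensional. -/
def IsConnectedAlgebra {C : Type*} [Category C] [Preadditive C] [Linear ℂ C]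
    [MonoidalCategory C] (X : C) : Prop :=
  Module.finrank ℂ (𝟙_ C ⟶ X) = 1

/-- The exchange relations `b ∘ μ ∘ (b ⊗ id) = μ ∘ (b ⊗ b) = b ∘ μ ∘ (id ⊗ b)`. -/
def SatisfiesExchangeRelations {C : Type*} [Category C] [MonoidalCategory C] {X : C} [MonObj X]
    (b : X ⟶ X) : Prop :=
  (b ▷ X) ≫ μ[X] ≫ b = (b ⊗ₘ b) ≫ μ[X] ∧ (b ⊗ₘ b) ≫ μ[X] = (X ◁ b) ≫ μ[X] ≫ b

/-- `b` arises from a unitary Frobenius subalgebra of `X`: there are a unitary Frobenius algebra `Y`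
and a unital algebra monomorphism `i : Y ⟶ X` with `i† ∘ i = id` and `b = i ∘ i†`. -/
def ArisesFromUnitaryFrobeniusSubalgebra {C : Type*} [Category C] [MonoidalCategory C]
    [DaggerCategory C] {X : C} [MonObj X] (b : X ⟶ X) : Prop :=
  ∃ (Y : C) (_ : FrobeniusObj Y) (i : Y ⟶ X), FrobeniusObj.IsUnitary Y ∧ IsMonHom i ∧ Mono i ∧
    i ≫ DaggerCategory.dagger i = 𝟙 Y ∧ b = DaggerCategory.dagger i ≫ i

/-! Let `b = i ∘ i†` with `i : Y ⟶ X` an isometric algebra map. The exchange relations follow once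
`i†` is left and right `Y`-linear, with `Y` acting on `X` through `i` (`mul_dagger_left`,
`mul_dagger_right`). That linearity holds as soon as `i†` is the transpose of `i`, on both sides,
for the Frobenius copairings.

The point is thus to identify the transpose `bend i` with `i†`. Connectedness makes partial traces
scalar, so left and right traces agree (`leftTrace_eq_rightTrace`). These traces are positive and
faithful, and two trace computations give `bend (bend i) = i` (`bend_bend_eq_self`) and then `bend i
= i†` (`bend_eq_dagger`).

Conversely, split `b = i ∘ i†` and compress the product of `X` to `Y`. The exchange relations make
`Y` closed under the product and `i†` linear over `Y` on both sides, so the Frobenius identities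
descend; the coalgebra structure is the adjoint of the algebra structure. -/

open DaggerCategory

/-! ### Positivity in the C*-category -/

section Dagger

variable {C : Type*} [Category C] [Preadditive C] [Linear ℂ C]

theorem dagger_sub [CStarCategory C] {X Y : C} (f g : X ⟶ Y) :
    dagger (f - g) = dagger f - dagger g := by
  have h := CStarCategory.dagger_add (f - g) g
  rw [sub_add_cancel] at h
  rw [h, add_sub_cancel_right]

theorem eq_zero_of_comp_dagger_eq_zero [CStarCategory C] {X Y : C} {f : X ⟶ Y}
    (hf : f ≫ dagger f = 0) : f = 0 := by
  apply CStarCategory.eq_zero_of_homNorm_eq_zero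
  have h := CStarCategory.homNorm_comp_dagger f
  have h0 := CStarCategory.homNorm_smul (0 : ℂ) (0 : X ⟶ X)
  rw [smul_zero, norm_zero, zero_mul] at h0
  rw [hf, h0] at h
  exact pow_eq_zero_iff (two_ne_zero) |>.1 h.symm

variable [MonoidalCategory C] [MonoidalPreadditive C] [MonoidalLinear ℂ C]

section CStarTensor

variable [CStarTensorCategory C]

theorem dagger_whiskerRight {X Y : C} (f : X ⟶ Y) (Z : C) :
    dagger (f ▷ Z) = dagger f ▷ Z := by
  rw [← tensorHom_id, CStarTensorCategory.dagger_tensorHom, dagger_id, tensorHom_id]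

theorem dagger_whiskerLeft {X Y : C} (Z : C) (f : X ⟶ Y) :
    dagger (Z ◁ f) = Z ◁ dagger f := by
  rw [← id_tensorHom, CStarTensorCategory.dagger_tensorHom, dagger_id, id_tensorHom]

end CStarTensor

variable [RigidCategory C] [UnitaryTensorCategory C]

theorem exists_eq_smul_id_unit (f : 𝟙_ C ⟶ 𝟙_ C) : ∃ c : ℂ, f = c • 𝟙 (𝟙_ C) := by
  have h1 : (𝟙 (𝟙_ C)) ≠ 0 := by
    intro h0
    have hs : ∀ f : 𝟙_ C ⟶ 𝟙_ C, f = 0 := fun f ↦ by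
      rw [← Category.id_comp f, h0, Limits.zero_comp]
    have : Subsingleton (𝟙_ C ⟶ 𝟙_ C) := ⟨fun f g ↦ by rw [hs f, hs g]⟩
    have := UnitaryTensorCategory.finrank_end_unit (C := C)
    rw [Module.finrank_zero_of_subsingleton] at this
    exact zero_ne_one this
  obtain ⟨c, hc⟩ := (finrank_eq_one_iff_of_nonzero' _ h1).1
    (UnitaryTensorCategory.finrank_end_unit (C := C)) f
  exact ⟨c, hc.symm⟩

/-- Positivity replaces `u` by an endomorphism of the unit, which is a scalar `c`; the composite is
then `|c|²`. -/
theorem exists_comp_dagger_eq_smul_id_unit {Z : C} (u : 𝟙_ C ⟶ Z) :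
    ∃ r : ℝ, 0 ≤ r ∧ u ≫ dagger u = (r : ℂ) • 𝟙 (𝟙_ C) := by
  obtain ⟨g, hg⟩ := CStarCategory.exists_comp_dagger_eq u
  obtain ⟨c, rfl⟩ := exists_eq_smul_id_unit g
  refine ⟨Complex.normSq c, Complex.normSq_nonneg c, ?_⟩
  rw [hg, CStarCategory.dagger_smul, dagger_id, Complex.normSq_eq_conj_mul_self]
  simp [smul_smul, mul_comm]

/-- Elements `u† ∘ u` of `End 𝟙` are nonnegative, so a sum of two of them vanishes only if both
summands do. -/
theorem eq_zero_of_comp_dagger_add_eq_zero {Z W : C} {u : 𝟙_ C ⟶ Z} {v : 𝟙_ C ⟶ W}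
    (h : u ≫ dagger u + v ≫ dagger v = 0) : v = 0 := by
  apply eq_zero_of_comp_dagger_eq_zero
  obtain ⟨r, hr, hu⟩ := exists_comp_dagger_eq_smul_id_unit u
  obtain ⟨s, hs, hv⟩ := exists_comp_dagger_eq_smul_id_unit v
  rw [hv]
  rw [hu, hv, ← add_smul] at h
  rcases smul_eq_zero.1 h with h | h
  · have h' : r + s = 0 := by exact_mod_cast h
    have : s = 0 := by linarith
    simp [this]
  · rw [h, smul_zero]

end Dagger

/-! ### Frobenius self-duality and transposes -/

section Pairing

variable {C : Type*} [Category C] [MonoidalCategory C]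

/-- The copairing `Δ ∘ η` of a Frobenius algebra. -/
def copairing (X : C) [FrobeniusObj X] : 𝟙_ C ⟶ X ⊗ X := η[X] ≫ Δ[X]

/-- The pairing `ε ∘ μ` of a Frobenius algebra. -/
def pairing (X : C) [FrobeniusObj X] : X ⊗ X ⟶ 𝟙_ C := μ[X] ≫ ε[X]

variable (X : C) [FrobeniusObj X]

theorem comul_eq_copairing_whiskerRight :
    Δ[X] = (λ_ X).inv ≫ copairing X ▷ X ≫ (α_ X X X).hom ≫ X ◁ μ[X] := by
  rw [copairing, comp_whiskerRight, Category.assoc, FrobeniusObj.comul_whiskerRight_mul,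
    one_mul_assoc, Iso.inv_hom_id_assoc]

theorem comul_eq_whiskerLeft_copairing :
    Δ[X] = (ρ_ X).inv ≫ X ◁ copairing X ≫ (α_ X X X).inv ≫ μ[X] ▷ X := by
  rw [copairing, whiskerLeft_comp, Category.assoc, FrobeniusObj.whiskerLeft_comul_mul,
    mul_one_assoc, Iso.inv_hom_id_assoc]

theorem copairing_pairing_left :
    copairing X ▷ X ≫ (α_ X X X).hom ≫ X ◁ pairing X = (λ_ X).hom ≫ (ρ_ X).inv := by
  have h := congrArg (fun t ↦ (λ_ X).hom ≫ t ≫ X ◁ ε[X]) (comul_eq_copairing_whiskerRight X)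
  simp only [Category.assoc, Iso.hom_inv_id_assoc, comul_counit] at h
  rw [h, pairing, whiskerLeft_comp]

theorem copairing_pairing_right :
    X ◁ copairing X ≫ (α_ X X X).inv ≫ pairing X ▷ X = (ρ_ X).hom ≫ (λ_ X).inv := by
  have h := congrArg (fun t ↦ (ρ_ X).hom ≫ t ≫ ε[X] ▷ X) (comul_eq_whiskerLeft_copairing X)
  simp only [Category.assoc, Iso.hom_inv_id_assoc, counit_comul] at h
  rw [h, pairing, comp_whiskerRight]

variable {X}

/-- Nondegeneracy of the copairing: a snake identity recovers `f`. This is what makes the traces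
faithful. -/
theorem eq_of_copairing_whiskerRight {Z : C} {f g : X ⟶ Z}
    (h : copairing X ≫ f ▷ X = copairing X ≫ g ▷ X) : f = g := by
  have key : ∀ f : X ⟶ Z, f = (λ_ X).inv ≫ (copairing X ≫ f ▷ X) ▷ X ≫ (α_ Z X X).hom ≫
      Z ◁ pairing X ≫ (ρ_ Z).hom := fun f ↦ by
    have e : (copairing X ≫ f ▷ X) ▷ X ≫ (α_ Z X X).hom ≫ Z ◁ pairing X ≫ (ρ_ Z).hom =
        (copairing X ▷ X ≫ (α_ X X X).hom ≫ X ◁ pairing X) ≫ (ρ_ X).hom ≫ f := by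
      rw [comp_whiskerRight, Category.assoc, Category.assoc, Category.assoc,
        associator_naturality_left_assoc, ← whisker_exchange_assoc]
      simp
    rw [e, copairing_pairing_left]
    simp
  rw [key f, key g, h]

theorem eq_of_copairing_whiskerLeft {Z : C} {f g : X ⟶ Z}
    (h : copairing X ≫ X ◁ f = copairing X ≫ X ◁ g) : f = g := by
  have key : ∀ f : X ⟶ Z, f = (ρ_ X).inv ≫ X ◁ (copairing X ≫ X ◁ f) ≫ (α_ X X Z).inv ≫
      pairing X ▷ Z ≫ (λ_ Z).hom := fun f ↦ by
    have e : X ◁ (copairing X ≫ X ◁ f) ≫ (α_ X X Z).inv ≫ pairing X ▷ Z ≫ (λ_ Z).hom =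
        (X ◁ copairing X ≫ (α_ X X X).inv ≫ pairing X ▷ X) ≫ (λ_ X).hom ≫ f := by
      rw [whiskerLeft_comp, Category.assoc, Category.assoc, Category.assoc,
        associator_inv_naturality_right_assoc, whisker_exchange_assoc]
      simp
    rw [e, copairing_pairing_right]
    simp
  rw [key f, key g, h]

variable {Y : C} [FrobeniusObj Y]

/-- The partial transpose of a morphism with respect to the pairings of two Frobenius algebras. -/
def bend (a : Y ⟶ X) : X ⟶ Y :=
  (λ_ X).inv ≫ copairing Y ▷ X ≫ (α_ Y Y X).hom ≫ Y ◁ (a ▷ X ≫ pairing X) ≫ (ρ_ Y).hom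

theorem whiskerLeft_bend_pairing (a : Y ⟶ X) :
    Y ◁ bend a ≫ pairing Y = a ▷ X ≫ pairing X := by
  have e : Y ◁ bend a ≫ pairing Y =
      (Y ◁ (λ_ X).inv ≫ (α_ Y (𝟙_ C) X).inv ≫
        (Y ◁ copairing Y ≫ (α_ Y Y Y).inv ≫ pairing Y ▷ Y) ▷ X) ≫ (α_ (𝟙_ C) Y X).hom ≫
        (λ_ (Y ⊗ X)).hom ≫ a ▷ X ≫ pairing X := by
    have h : pairing Y = (ρ_ (Y ⊗ Y)).inv ≫ pairing Y ▷ (𝟙_ C) ≫ (λ_ (𝟙_ C)).hom := by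
      monoidal
    have h2 : (λ_ (Y ⊗ X)).hom ≫ a ▷ X ≫ pairing X =
        (𝟙_ C) ◁ (a ▷ X ≫ pairing X) ≫ (λ_ (𝟙_ C)).hom := by
      monoidal
    rw [h2]
    simp only [Category.assoc, comp_whiskerRight]
    have h3 : (pairing Y ▷ Y) ▷ X ≫ (α_ (𝟙_ C) Y X).hom ≫ (𝟙_ C) ◁ (a ▷ X ≫ pairing X) =
        (α_ (Y ⊗ Y) Y X).hom ≫ (Y ⊗ Y) ◁ (a ▷ X ≫ pairing X) ≫ pairing Y ▷ (𝟙_ C) := by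
      rw [associator_naturality_left_assoc, whisker_exchange]
    rw [reassoc_of% h3, h, bend]
    monoidal
  rw [e, copairing_pairing_right]
  monoidal

theorem copairing_bend_whiskerRight (a : Y ⟶ X) :
    copairing X ≫ bend a ▷ X = copairing Y ≫ Y ◁ a := by
  have e : copairing X ≫ bend a ▷ X =
      copairing Y ≫ (Y ◁ (a ≫ (ρ_ X).inv)) ≫ Y ◁ (X ◁ copairing X ≫ (α_ X X X).inv ≫
        pairing X ▷ X) ≫ Y ◁ (λ_ X).hom := by
    have h2 : copairing Y ≫ Y ◁ (a ≫ (ρ_ X).inv) ≫ Y ◁ X ◁ copairing X =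
        copairing X ≫ (λ_ (X ⊗ X)).inv ≫ copairing Y ▷ (X ⊗ X) ≫
          (α_ Y Y (X ⊗ X)).hom ≫ Y ◁ a ▷ (X ⊗ X) := by
      have h3 : copairing X ≫ (λ_ (X ⊗ X)).inv ≫ copairing Y ▷ (X ⊗ X) =
          copairing Y ≫ (ρ_ _).inv ≫ (Y ⊗ Y) ◁ copairing X := by
        rw [leftUnitor_inv_naturality_assoc, whisker_exchange]
        monoidal
      rw [reassoc_of% h3]
      have h4 : Y ◁ Y ◁ copairing X ≫ Y ◁ a ▷ (X ⊗ X) =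
          Y ◁ a ▷ (𝟙_ C) ≫ Y ◁ X ◁ copairing X := by
        rw [← whiskerLeft_comp, whisker_exchange, whiskerLeft_comp]
      rw [associator_naturality_right_assoc, h4]
      monoidal
    simp only [whiskerLeft_comp, Category.assoc] at h2 ⊢
    rw [reassoc_of% h2, bend]
    monoidal
  rw [e, copairing_pairing_right]
  monoidal

end Pairing

/-! ### Partial traces and sphericality -/

section Partial

variable {C : Type*} [Category C] [MonoidalCategory C] {X : C} [FrobeniusObj X]

/-- The partial trace `μ ∘ (f ⊗ id) ∘ Δ`. -/
def leftPartialTrace (f : X ⟶ X) : X ⟶ X := Δ[X] ≫ f ▷ X ≫ μ[X]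

/-- The partial trace `μ ∘ (id ⊗ f) ∘ Δ`. -/
def rightPartialTrace (f : X ⟶ X) : X ⟶ X := Δ[X] ≫ X ◁ f ≫ μ[X]

/-- Right linearity, from the Frobenius identity and associativity: the partial trace is determined
by its value on the unit. -/
theorem mul_leftPartialTrace (f : X ⟶ X) :
    μ[X] ≫ leftPartialTrace f = leftPartialTrace f ▷ X ≫ μ[X] := by
  rw [leftPartialTrace, ← Category.assoc, ← FrobeniusObj.comul_whiskerRight_mul]
  simp only [Category.assoc, comp_whiskerRight, MonObj.mul_assoc]
  rw [whisker_exchange_assoc, associator_naturality_left_assoc]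

theorem mul_rightPartialTrace (f : X ⟶ X) :
    μ[X] ≫ rightPartialTrace f = X ◁ rightPartialTrace f ≫ μ[X] := by
  rw [rightPartialTrace, ← Category.assoc, ← FrobeniusObj.whiskerLeft_comul_mul]
  simp only [Category.assoc, whiskerLeft_comp]
  rw [← whisker_exchange_assoc, ← associator_inv_naturality_right_assoc, MonObj.mul_assoc]
  simp

/-- By (co)associativity both sides are the threefold comultiplication, `f` on the middle leg, then
the threefold product. -/
theorem comul_rightPartialTrace_mul (f : X ⟶ X) :
    Δ[X] ≫ rightPartialTrace f ▷ X ≫ μ[X] = Δ[X] ≫ X ◁ leftPartialTrace f ≫ μ[X] := by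
  simp only [leftPartialTrace, rightPartialTrace, whiskerLeft_comp, comp_whiskerRight,
    Category.assoc, MonObj.mul_assoc, ComonObj.comul_assoc_assoc]
  simp

/-- The left trace `E ∘ (f ⊗ id) ∘ R` given by the pairing `E` and the copairing `R`. -/
def leftTrace (f : X ⟶ X) : 𝟙_ C ⟶ 𝟙_ C := copairing X ≫ f ▷ X ≫ pairing X

/-- The right trace `E ∘ (id ⊗ f) ∘ R` given by the pairing `E` and the copairing `R`. -/
def rightTrace (f : X ⟶ X) : 𝟙_ C ⟶ 𝟙_ C := copairing X ≫ X ◁ f ≫ pairing X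

variable {Y : C} [FrobeniusObj Y]

/-- Sliding `i` around the loop transposes it twice, so failure of cyclicity is measured by `bend
(bend i)`. -/
theorem leftTrace_comp_eq_bend_bend (i : Y ⟶ X) (a : X ⟶ Y) :
    leftTrace (a ≫ i) = leftTrace (bend (bend i) ≫ a) := by
  simp only [leftTrace, comp_whiskerRight, Category.assoc]
  rw [← whiskerLeft_bend_pairing, ← whisker_exchange_assoc,
    ← reassoc_of% (copairing_bend_whiskerRight (bend i))]

theorem rightTrace_bend_bend_comp (i : Y ⟶ X) (a : X ⟶ Y) :
    rightTrace (a ≫ bend (bend i)) = rightTrace (i ≫ a) := by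
  simp only [rightTrace, whiskerLeft_comp, Category.assoc]
  rw [whiskerLeft_bend_pairing, whisker_exchange_assoc,
    reassoc_of% (copairing_bend_whiskerRight i)]

variable [Preadditive C] [MonoidalPreadditive C]

theorem rightTrace_sub (f g : X ⟶ X) : rightTrace (f - g) = rightTrace f - rightTrace g := by
  have h : X ◁ (f - g) = X ◁ f - X ◁ g :=
    (tensoringLeft C).obj X |>.map_sub
  simp [rightTrace, h]

variable [Linear ℂ C] [MonoidalLinear ℂ C]

theorem leftPartialTrace_eq_smul (hX : ∀ u : 𝟙_ C ⟶ X, ∃ c : ℂ, u = c • η[X]) (f : X ⟶ X) :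
    ∃ c : ℂ, leftPartialTrace f = c • 𝟙 X := by
  obtain ⟨c, hc⟩ := hX (η[X] ≫ leftPartialTrace f)
  refine ⟨c, ?_⟩
  rw [← cancel_epi (λ_ X).hom, ← MonObj.one_mul, Category.assoc, mul_leftPartialTrace,
    ← comp_whiskerRight_assoc, hc]
  simp

theorem rightPartialTrace_eq_smul (hX : ∀ u : 𝟙_ C ⟶ X, ∃ c : ℂ, u = c • η[X]) (f : X ⟶ X) :
    ∃ c : ℂ, rightPartialTrace f = c • 𝟙 X := by
  obtain ⟨c, hc⟩ := hX (η[X] ≫ rightPartialTrace f)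
  refine ⟨c, ?_⟩
  rw [← cancel_epi (ρ_ X).hom, ← MonObj.mul_one, Category.assoc, mul_rightPartialTrace,
    ← whiskerLeft_comp_assoc, hc]
  simp

/-- The pairing of a connected unitary Frobenius algebra is spherical. -/
theorem leftTrace_eq_rightTrace [RigidCategory C] [UnitaryTensorCategory C]
    (hU : FrobeniusObj.IsUnitary X)
    (hX : ∀ u : 𝟙_ C ⟶ X, ∃ c : ℂ, u = c • η[X]) (f : X ⟶ X) :
    leftTrace f = rightTrace f := by
  obtain ⟨c, hc⟩ := leftPartialTrace_eq_smul hX f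
  obtain ⟨d, hd⟩ := rightPartialTrace_eq_smul hX f
  have h1 : Δ[X] ≫ μ[X] = leftPartialTrace (𝟙 X) := by simp [leftPartialTrace]
  obtain ⟨l, hl⟩ := leftPartialTrace_eq_smul hX (𝟙 X)
  rw [hl] at h1
  have h2 := comul_rightPartialTrace_mul f
  rw [hc, hd] at h2
  simp only [MonoidalLinear.smul_whiskerRight, MonoidalLinear.whiskerLeft_smul, id_whiskerRight,
    whiskerLeft_id, Linear.smul_comp, Linear.comp_smul, Category.id_comp, h1, smul_smul] at h2
  have hL : leftTrace f = c • (η[X] ≫ ε[X]) := by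
    have : leftTrace f = η[X] ≫ leftPartialTrace f ≫ ε[X] := by
      simp [leftTrace, leftPartialTrace, copairing, pairing]
    rw [this, hc]; simp
  have hR : rightTrace f = d • (η[X] ≫ ε[X]) := by
    have : rightTrace f = η[X] ≫ rightPartialTrace f ≫ ε[X] := by
      simp [rightTrace, rightPartialTrace, copairing, pairing]
    rw [this, hd]; simp
  have h3 : (c - d) • l • 𝟙 X = 0 := by
    rw [sub_smul, smul_smul, smul_smul, ← h2, sub_self]
  rcases smul_eq_zero.1 h3 with h | h
  · rw [hL, hR, sub_eq_zero.1 h]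
  -- In the degenerate case `μ ∘ Δ = Δ† ∘ Δ` vanishes, hence so do `Δ` and both traces.
  · have h4 : Δ[X] = 0 := by
      apply eq_zero_of_comp_dagger_eq_zero
      rw [← hU.1, dagger_dagger, hU.1, h1, h]
    simp [leftTrace, rightTrace, copairing, h4]

end Partial

/-! ### From a subalgebra to the exchange relations -/

section Subalgebra

variable {C : Type*} [Category C] [Preadditive C] [Linear ℂ C]
  [MonoidalCategory C] [MonoidalPreadditive C] [MonoidalLinear ℂ C] [RigidCategory C]
  [UnitaryTensorCategory C] {X Y : C} [FrobeniusObj X] [FrobeniusObj Y]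

theorem dagger_copairing (hX : FrobeniusObj.IsUnitary X) :
    dagger (copairing X) = pairing X := by
  rw [copairing, pairing, dagger_comp, ← hX.1, dagger_dagger, hX.2]

theorem rightTrace_dagger_comp (hX : FrobeniusObj.IsUnitary X) {Z : C} (f : X ⟶ Z) :
    rightTrace (f ≫ dagger f) = (copairing X ≫ X ◁ f) ≫ dagger (copairing X ≫ X ◁ f) := by
  simp [rightTrace, dagger_comp, dagger_whiskerLeft, dagger_copairing hX]

theorem leftTrace_dagger_comp (hX : FrobeniusObj.IsUnitary X) {Z : C} (f : X ⟶ Z) :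
    leftTrace (f ≫ dagger f) = (copairing X ≫ f ▷ X) ≫ dagger (copairing X ≫ f ▷ X) := by
  simp [leftTrace, dagger_comp, dagger_whiskerRight, dagger_copairing hX]

variable (hX : FrobeniusObj.IsUnitary X) (hY : FrobeniusObj.IsUnitary Y)
  (hcX : ∀ u : 𝟙_ C ⟶ X, ∃ c : ℂ, u = c • η[X]) (hcY : ∀ u : 𝟙_ C ⟶ Y, ∃ c : ℂ, u = c • η[Y])

include hX hY hcX hcY in
-- With `d = i - bend (bend i)`, sphericality gives `tr (d ∘ a) = -tr (a ∘ d)`. For `a = d†` both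
-- traces are nonnegative, so they vanish.
theorem bend_bend_eq_self (i : Y ⟶ X) : bend (bend i) = i := by
  have key : ∀ a : X ⟶ Y, rightTrace (a ≫ (i - bend (bend i))) +
      leftTrace ((i - bend (bend i)) ≫ a) = 0 := fun a ↦ by
    rw [leftTrace_eq_rightTrace hY hcY, Preadditive.comp_sub, Preadditive.sub_comp,
      rightTrace_sub, rightTrace_sub, rightTrace_bend_bend_comp,
      ← leftTrace_eq_rightTrace hX hcX, leftTrace_comp_eq_bend_bend,
      ← leftTrace_eq_rightTrace hY hcY (bend (bend i) ≫ a)]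
    abel
  have h := key (dagger (i - bend (bend i)))
  have h1 := rightTrace_dagger_comp hX (dagger (i - bend (bend i)))
  rw [dagger_dagger] at h1
  rw [h1, leftTrace_dagger_comp hY] at h
  have h2 := eq_zero_of_comp_dagger_add_eq_zero h
  have h3 : i - bend (bend i) = 0 := eq_of_copairing_whiskerRight (by rw [h2]; simp)
  exact (sub_eq_zero.1 h3).symm

/-- A multiplicative map preserving the counit preserves the nondegenerate pairing. -/
theorem comp_bend_eq_id (hY : FrobeniusObj.IsUnitary Y) (i : Y ⟶ X) [IsMonHom i]
    (hε : i ≫ ε[X] = ε[Y]) : i ≫ bend i = 𝟙 Y := by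
  have h1 : (i ⊗ₘ i) ≫ pairing X = pairing Y := by
    rw [pairing, pairing, ← IsMonHom.mul_hom_assoc, hε]
  have h2 : Y ◁ (i ≫ bend i) ≫ pairing Y = pairing Y := by
    rw [whiskerLeft_comp, Category.assoc, whiskerLeft_bend_pairing, ← h1,
      tensorHom_def'_assoc]
  have h3 := congrArg dagger h2
  rw [dagger_comp, ← dagger_copairing hY, dagger_dagger, dagger_whiskerLeft] at h3
  have h4 : dagger (i ≫ bend i) = 𝟙 Y := eq_of_copairing_whiskerLeft (by rw [h3]; simp)
  rw [← dagger_dagger (i ≫ bend i), h4, dagger_id]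

include hX hY hcX hcY in
/-- The partial transpose of an isometric algebra homomorphism is its adjoint. -/
theorem bend_eq_dagger (i : Y ⟶ X) [IsMonHom i] (hi : i ≫ dagger i = 𝟙 Y) :
    bend i = dagger i := by
  have hη : η[X] ≫ dagger i = η[Y] := by
    rw [← IsMonHom.one_hom (f := i), Category.assoc, hi, Category.comp_id]
  have hε : i ≫ ε[X] = ε[Y] := by
    rw [← hX.2, ← hY.2, ← hη, dagger_comp, dagger_dagger]
  have hbb := bend_bend_eq_self hX hY hcX hcY i
  have hib := comp_bend_eq_id hY i hε
  have t (a : X ⟶ Y) : rightTrace (a ≫ i) = rightTrace (i ≫ a) := by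
    conv_lhs => rw [← hbb]
    exact rightTrace_bend_bend_comp i a
  have h1 : rightTrace (bend i ≫ dagger (bend i)) = rightTrace (𝟙 Y) := by
    have e : copairing X ≫ X ◁ bend i = copairing Y ≫ i ▷ Y := by
      rw [← copairing_bend_whiskerRight (bend i), hbb]
    rw [rightTrace_dagger_comp hX, e, ← leftTrace_dagger_comp hY, hi,
      leftTrace_eq_rightTrace hY hcY]
  have h2 : rightTrace (bend i ≫ i) = rightTrace (𝟙 Y) := by rw [t, hib]
  have h3 : rightTrace (dagger i ≫ i) = rightTrace (𝟙 Y) := by rw [t, hi]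
  have hd (f : X ⟶ X) : rightTrace (dagger f) = dagger (rightTrace f) := by
    simp only [rightTrace, dagger_comp, dagger_whiskerLeft, ← dagger_copairing hX,
      dagger_dagger, Category.assoc]
  have hd1 : dagger (rightTrace (𝟙 Y)) = rightTrace (𝟙 Y) := by
    simp [rightTrace, dagger_comp, ← dagger_copairing hY, dagger_dagger]
  have h4 : rightTrace (dagger i ≫ dagger (bend i)) = rightTrace (𝟙 Y) := by
    rw [← dagger_comp, hd, h2, hd1]
  -- All four terms of the expansion have the trace of `𝟙 Y`, so they cancel.
  have h5 : rightTrace ((bend i - dagger i) ≫ dagger (bend i - dagger i)) = 0 := by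
    rw [dagger_sub, dagger_dagger, Preadditive.sub_comp, Preadditive.comp_sub,
      Preadditive.comp_sub, rightTrace_sub, rightTrace_sub, rightTrace_sub, h1, h2, h3, h4]
    simp
  rw [rightTrace_dagger_comp hX] at h5
  have h6 : bend i - dagger i = 0 :=
    eq_of_copairing_whiskerLeft (by rw [eq_zero_of_comp_dagger_eq_zero h5]; simp)
  exact sub_eq_zero.1 h6

/-- Left `Y`-linearity of `i†`. Its adjoint is proved instead: write `Δ` through the copairing,
transpose by `h`, and use multiplicativity of `i`. -/
theorem mul_dagger_left (hX : FrobeniusObj.IsUnitary X) (hY : FrobeniusObj.IsUnitary Y)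
    (i : Y ⟶ X) [IsMonHom i]
    (h : copairing X ≫ dagger i ▷ X = copairing Y ≫ Y ◁ i) :
    i ▷ X ≫ μ[X] ≫ dagger i = Y ◁ dagger i ≫ μ[Y] := by
  have e : i ≫ Δ[X] ≫ dagger i ▷ X = Δ[Y] ≫ Y ◁ i := by
    rw [comul_eq_copairing_whiskerRight X, comul_eq_copairing_whiskerRight Y]
    simp only [Category.assoc]
    rw [whisker_exchange, ← associator_naturality_left_assoc, ← comp_whiskerRight_assoc, h,
      leftUnitor_inv_naturality_assoc, ← whiskerLeft_comp, IsMonHom.mul_hom,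
      MonoidalCategory.tensorHom_def, whisker_exchange_assoc]
    monoidal
  have e' := congrArg dagger e
  simpa [dagger_comp, dagger_whiskerLeft, dagger_whiskerRight, ← hX.1, ← hY.1, dagger_dagger]
    using e'

theorem mul_dagger_right (hX : FrobeniusObj.IsUnitary X) (hY : FrobeniusObj.IsUnitary Y)
    (i : Y ⟶ X) [IsMonHom i]
    (h : copairing X ≫ X ◁ dagger i = copairing Y ≫ i ▷ Y) :
    X ◁ i ≫ μ[X] ≫ dagger i = dagger i ▷ Y ≫ μ[Y] := by
  have e : i ≫ Δ[X] ≫ X ◁ dagger i = Δ[Y] ≫ i ▷ Y := by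
    rw [comul_eq_whiskerLeft_copairing X, comul_eq_whiskerLeft_copairing Y]
    simp only [Category.assoc]
    rw [← whisker_exchange, ← associator_inv_naturality_right_assoc, ← whiskerLeft_comp_assoc, h,
      rightUnitor_inv_naturality_assoc, ← comp_whiskerRight, IsMonHom.mul_hom, tensorHom_def',
      ← whisker_exchange_assoc]
    monoidal
  have e' := congrArg dagger e
  simpa [dagger_comp, dagger_whiskerLeft, dagger_whiskerRight, ← hX.1, ← hY.1, dagger_dagger]
    using e'

include hX hY hcX hcY in
theorem satisfiesExchangeRelations_of_isMonHom (i : Y ⟶ X) [IsMonHom i]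
    (hi : i ≫ dagger i = 𝟙 Y) : SatisfiesExchangeRelations (dagger i ≫ i) := by
  have hb := bend_eq_dagger hX hY hcX hcY i hi
  have h1 := copairing_bend_whiskerRight i
  have h2 := copairing_bend_whiskerRight (bend i)
  rw [bend_bend_eq_self hX hY hcX hcY i] at h2
  rw [hb] at h1 h2
  have hl := mul_dagger_left hX hY i h1
  have hr := mul_dagger_right hX hY i h2.symm
  have hm : ((dagger i ≫ i) ⊗ₘ (dagger i ≫ i)) ≫ μ[X] =
      (dagger i ⊗ₘ dagger i) ≫ μ[Y] ≫ i := by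
    rw [← tensorHom_comp_tensorHom, Category.assoc, IsMonHom.mul_hom]
  constructor
  · rw [hm, comp_whiskerRight, Category.assoc, reassoc_of% hl,
      MonoidalCategory.tensorHom_def, Category.assoc]
  · rw [hm, whiskerLeft_comp, Category.assoc, reassoc_of% hr, tensorHom_def', Category.assoc]

end Subalgebra

/-! ### From the exchange relations to a subalgebra -/

section Splitting

variable {C : Type*} [Category C] [Preadditive C] [Linear ℂ C]
  [MonoidalCategory C] [MonoidalPreadditive C] [MonoidalLinear ℂ C] [CStarTensorCategory C]
  {X Y : C} [FrobeniusObj X]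

/-- The range of a projection satisfying the exchange relations inherits a Frobenius algebra
structure. -/
theorem arises_of_satisfiesExchangeRelations (hX : FrobeniusObj.IsUnitary X) {b : X ⟶ X}
    (hη : η[X] ≫ b = η[X]) (hex : SatisfiesExchangeRelations b) (i : Y ⟶ X)
    (hi : i ≫ dagger i = 𝟙 Y) (hb : dagger i ≫ i = b) :
    ArisesFromUnitaryFrobeniusSubalgebra b := by
  have hib : i ≫ b = i := by rw [← hb, ← Category.assoc, hi, Category.id_comp]
  have hbi : b ≫ dagger i = dagger i := by rw [← hb, Category.assoc, hi, Category.comp_id]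
  have : Mono i := ⟨fun f g h ↦ by
    have := congrArg (· ≫ dagger i) h
    simpa [hi] using this⟩
  have hbb : b ≫ b = b := by rw [← hb, Category.assoc, ← Category.assoc i, hi, Category.id_comp]
  let m : Y ⊗ Y ⟶ Y := (i ⊗ₘ i) ≫ μ[X] ≫ dagger i
  let u : 𝟙_ C ⟶ Y := η[X] ≫ dagger i
  have hu : u ≫ i = η[X] := by simp only [u, Category.assoc, hb, hη]
  have hm : m ≫ i = (i ⊗ₘ i) ≫ μ[X] := by
    -- The range of `b` is closed under the product.
    have h : (b ⊗ₘ b) ≫ μ[X] ≫ b = (b ⊗ₘ b) ≫ μ[X] := by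
      rw [← reassoc_of% hex.1, hbb, hex.1]
    have h' := congrArg ((i ⊗ₘ i) ≫ ·) h
    simp only [tensorHom_comp_tensorHom_assoc, hib] at h'
    simp only [m, Category.assoc, hb, h']
  have h1 : u ▷ Y ≫ m = (λ_ Y).hom := by
    rw [← cancel_mono i, Category.assoc, hm, MonoidalCategory.tensorHom_def, Category.assoc,
      ← comp_whiskerRight_assoc, hu, ← whisker_exchange_assoc]
    simp
  have h2 : Y ◁ u ≫ m = (ρ_ Y).hom := by
    rw [← cancel_mono i, Category.assoc, hm, tensorHom_def', Category.assoc,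
      ← whiskerLeft_comp_assoc, hu, whisker_exchange_assoc]
    simp
  have h3 : m ▷ Y ≫ m = (α_ Y Y Y).hom ≫ Y ◁ m ≫ m := by
    have hl : m ▷ Y ≫ (i ⊗ₘ i) = ((i ⊗ₘ i) ⊗ₘ i) ≫ μ[X] ▷ X := by
      rw [whiskerRight_comp_tensorHom, hm, tensorHom_comp_whiskerRight]
    have hr : Y ◁ m ≫ (i ⊗ₘ i) = (i ⊗ₘ (i ⊗ₘ i)) ≫ X ◁ μ[X] := by
      rw [whiskerLeft_comp_tensorHom, hm, tensorHom_comp_whiskerLeft]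
    rw [← cancel_mono i]
    simp only [Category.assoc, hm]
    rw [reassoc_of% hl, reassoc_of% hr, MonObj.mul_assoc, associator_naturality_assoc]
  -- The second exchange relation, restricted along `i`, is right `Y`-linearity of `i†`; the first
  -- gives left linearity in `hrm`.
  have hlm : dagger i ▷ Y ≫ m = X ◁ i ≫ μ[X] ≫ dagger i := by
    have h := congrArg (X ◁ i ≫ · ≫ dagger i) hex.2
    simp only [Category.assoc, hbi, ← whiskerLeft_comp_assoc, hib] at h
    rw [← h, whiskerLeft_comp_tensorHom_assoc, whiskerRight_comp_tensorHom_assoc, hib, hb]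
  have hrm : Y ◁ dagger i ≫ m = i ▷ X ≫ μ[X] ≫ dagger i := by
    have h := congrArg (i ▷ X ≫ · ≫ dagger i) hex.1
    simp only [Category.assoc, hbi, ← comp_whiskerRight_assoc, hib] at h
    rw [h, whiskerRight_comp_tensorHom_assoc, whiskerLeft_comp_tensorHom_assoc, hib, hb]
  have hd : dagger m = i ≫ Δ[X] ≫ (dagger i ⊗ₘ dagger i) := by
    simp only [m, dagger_comp, dagger_dagger, CStarTensorCategory.dagger_tensorHom, hX.1,
      Category.assoc]
  have hmd : m ≫ dagger m = (i ⊗ₘ i) ≫ μ[X] ≫ Δ[X] ≫ (dagger i ⊗ₘ dagger i) := by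
    rw [hd, reassoc_of% hm]
  clear_value m u
  let F : FrobeniusObj Y :=
    { one := u
      mul := m
      one_mul := h1
      mul_one := h2
      mul_assoc := h3
      counit := dagger u
      comul := dagger m
      counit_comul := by
        rw [← CStarTensorCategory.dagger_leftUnitor_hom, ← h1, dagger_comp, dagger_whiskerRight]
      comul_counit := by
        rw [← CStarTensorCategory.dagger_rightUnitor_hom, ← h2, dagger_comp, dagger_whiskerLeft]
      comul_assoc := by
        have h := congrArg dagger h3
        simp only [dagger_comp, dagger_whiskerLeft, dagger_whiskerRight,
          CStarTensorCategory.dagger_associator_hom, Category.assoc] at h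
        rw [reassoc_of% h]
        simp
      -- By `hlm`, the `i†` coming from `dagger m` passes through the product, leaving the Frobenius
      -- identity of `X`.
      comul_whiskerRight_mul := by
        have h : dagger i ▷ X ▷ Y ≫ (α_ Y X Y).hom ≫ Y ◁ X ◁ i =
            (α_ X X Y).hom ≫ X ◁ X ◁ i ≫ dagger i ▷ (X ⊗ X) := by
          rw [associator_naturality_left_assoc, whisker_exchange]
        rw [hmd, ← reassoc_of% (FrobeniusObj.comul_whiskerRight_mul (X := X)), hd,
          MonoidalCategory.tensorHom_def (dagger i)]
        simp only [comp_whiskerRight, Category.assoc]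
        rw [associator_naturality_middle_assoc, ← whiskerLeft_comp, hlm]
        simp only [whiskerLeft_comp]
        rw [reassoc_of% h, MonoidalCategory.tensorHom_def i,
          whisker_exchange_assoc (dagger i) μ[X]]
        simp only [Category.assoc]
        rw [whisker_exchange_assoc Δ[X] i]
        monoidal
      whiskerLeft_comul_mul := by
        have h : Y ◁ X ◁ dagger i ≫ (α_ Y X Y).inv ≫ i ▷ X ▷ Y =
            i ▷ (X ⊗ X) ≫ (α_ X X X).inv ≫ (X ⊗ X) ◁ dagger i := by
          rw [associator_inv_naturality_right_assoc, whisker_exchange,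
            associator_inv_naturality_left_assoc]
        rw [hmd, ← reassoc_of% (FrobeniusObj.whiskerLeft_comul_mul (X := X)), hd,
          tensorHom_def' (dagger i)]
        simp only [whiskerLeft_comp, Category.assoc]
        rw [associator_inv_naturality_middle_assoc, ← comp_whiskerRight, hrm]
        simp only [comp_whiskerRight]
        rw [reassoc_of% h, tensorHom_def' i, ← whisker_exchange_assoc (μ[X])]
        simp only [Category.assoc]
        rw [← whisker_exchange_assoc i] }
  exact ⟨Y, F, i, ⟨rfl, rfl⟩, ⟨hu, hm⟩, this, hi, hb.symm⟩

end Splitting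

theorem theorem4p8 {C : Type*} [Category C] [Preadditive C] [Linear ℂ C]
    [MonoidalCategory C] [MonoidalPreadditive C] [MonoidalLinear ℂ C] [RigidCategory C]
    [UnitaryTensorCategory C] (X : C) [FrobeniusObj X] (hX : FrobeniusObj.IsUnitary X)
    (hconn : IsConnectedAlgebra X) (b : X ⟶ X) (hunital : η[X] ≫ b = η[X])
    (hselfAdjoint : DaggerCategory.dagger b = b) (hidem : b ≫ b = b) :
    ArisesFromUnitaryFrobeniusSubalgebra b ↔ SatisfiesExchangeRelations b := by
  constructor
  · rintro ⟨Y, _, i, hY, _, _, hi, rfl⟩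
    have hη : η[X] ≠ 0 := by
      intro h0
      have hs : ∀ f : 𝟙_ C ⟶ X, f = 0 := fun f ↦ by
        have h : f = (λ_ _).inv ≫ (𝟙_ C) ◁ f ≫ η[X] ▷ X ≫ μ[X] := by simp
        rw [h, h0]
        simp
      have : Subsingleton (𝟙_ C ⟶ X) := ⟨fun f g ↦ by rw [hs f, hs g]⟩
      rw [IsConnectedAlgebra, Module.finrank_zero_of_subsingleton] at hconn
      exact zero_ne_one hconn
    have hcX : ∀ u : 𝟙_ C ⟶ X, ∃ c : ℂ, u = c • η[X] := fun u ↦ by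
      obtain ⟨c, hc⟩ := (finrank_eq_one_iff_of_nonzero' _ hη).1 hconn u
      exact ⟨c, hc.symm⟩
    -- Connectedness passes to `Y` because `i` is monic and unital.
    have hcY : ∀ u : 𝟙_ C ⟶ Y, ∃ c : ℂ, u = c • η[Y] := fun u ↦ by
      obtain ⟨c, hc⟩ := hcX (u ≫ i)
      refine ⟨c, ?_⟩
      rw [← cancel_mono i, hc, Linear.smul_comp, IsMonHom.one_hom]
    exact satisfiesExchangeRelations_of_isMonHom hX hY hcX hcY i hi
  · intro hex
    obtain ⟨Y, i, hi, hb⟩ :=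
      UnitaryTensorCategory.exists_isometry_of_projection b hidem hselfAdjoint
    exact arises_of_satisfiesExchangeRelations hX hunital hex i hi hb
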